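/- **The graph.** Let $n\ge 1$, $m\ge 0$, $k\ge 1$ be integers. The graph $L\text{-}RCube(n,m,k)$ has as vertices (servers) the strings $v_kv_{k-1}\cdots v_0$ with $v_0\in\{0,\dots,n+m-1\}$ and $v_i\in\{0,\dots,n-1\}$ for $1\le i\le k$. Two vertices are adjacent if and only if, for one of the two ways of naming them $u$ and $v$, one of the following holds: (1) $u_k\cdots u_1=v_k\cdots v_1$ and $u_0\ne v_0$; (2) $u_0<n$ and, for some $1\le i\le k$, $u_i\neq v_i$ while $u_j=v_j$ for all $j\ne i$; (3) $u_0\ge n$ and, for some $1\le i\le k$, $u_i\cdots u_1=v_{i-1}\cdots v_0$ and $u_j=v_j$ for all $j>i$. A block is the set of the $n+m$ vertices with a given $v_k\cdots v_1$ (it induces $K_{n+m}$). Blocks, and the vertices inside a block, are numbered in lexicographic order. **Completely independent spanning trees (CISTs).** Spanning trees $T_1,\dots,T_t$ of a graph $G$ are CISTs if for all $i\ne j$ they have no common edge and, for all vertices $x,y$, the $x$–$y$ paths in $T_i$ and in $T_j$ have no common vertex except $x$ and $y$. **The algorithm.** Put $s=\lfloor (n+m)/2\rfloor$, and $t=s$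 if $n=1$, $t=\min\{n,s\}$ otherwise. *Blocks.* For a block with vertices $v_1,\dots,v_N$, $N=n+m$, form for $1\le j\le s$ the edge set $$\{(v_j,v_{j+s})\}\cup\{(v_j,v_x):j+1\le x\le s+j-1\}\cup\{(v_{j+s},v_x):1\le x\le j-1\text{ or }s+j+1\le x\le N\}.$$ *Recursion.* If $n=1$, return the first $t$ of the trees of the block. If $n\ge2$, let $H_1,\dots,H_n$ be the $n$ subgraphs given by the leftmost symbol (blocks if $k=1$, copies of $L\text{-}RCube(n,m,k-1)$ if $k\ge2$). Compute trees $\tilde T_{i,1},\dots,\tilde T_{i,t}$ of every $H_i$: if $k=1$, as the first $t$ block trees; if $k\ge 2$, by a recursive call. With $v_{i,x}$ the $x$-th vertex of the first block of $H_i$, return for $1\le j\le t$ $$T_j=\Big(\bigcup_{i=1}^n\tilde T_{i,j}\cup\bigcup_{i=2}^n\{(v_{1,j},v_{i,j}),(v_{1,j+s},v_{i,j+s})\}\Big)\setminus\bigcup_{i=2}^n\{(v_{i,j},v_{i,j+s})\}\quad\text{if }m=0,$$ $$T_j=\bigcup_{i=1}^n\tilde T_{i,j}\cup\bigcup_{i=2}^n\{(v_{1,j},v_{i,j})\}\quad\text{if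 }m>0.$$ **Cost model.** Time is the number of elementary steps on a unit-cost RAM whose words hold parameters, indices and vertex labels. An edge set is stored as a linked list of cells; a cell is either a single edge, or a star, i.e. all edges from one vertex of a block to the vertices of an interval of the same block, given by its centre and the two ends of the interval. Creating a cell and concatenating two lists take one step each, and deleting a cell costs one step for each cell scanned from the head of the list. **Theorem.** There is an absolute constant $C$ such that for all integers $n\ge 1$, $m\ge 0$ with $n+m\ge 4$ and all $k\ge 2$, the algorithm, run on $(n,m,k)$, takes at most $C\,n^k(n+m)$ steps and returns $t$ completely independent spanning trees of $L\text{-}RCube(n,m,k)$, where $$t=\begin{cases}\lfloor(1+m)/2\rfloor&\text{if }n=1,\\ \min\{n,\lfloor(n+m)/2\rfloor\}&\text{otherwise.}\end{cases}$$ -/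

import Mathlib

namespace RCube

/-! ### The logic graph -/

/-- A server `a_k a_{k-1} ⋯ a_1 a_0`: `hi i` is the digit `a_{i+1} ∈ [0, n-1]` and `lo` is the
digit `a_0 ∈ [0, n+m-1]`. -/
structure Server (n m k : ℕ) where
  hi : Fin k → Fin n
  lo : Fin (n + m)

/-- The digit `a_j` of a server, for `0 ≤ j ≤ k`. -/
def Server.digit {n m k : ℕ} (u : Server n m k) (j : ℕ) : ℕ :=
  if j = 0 then u.lo else if h : j - 1 < k then u.hi ⟨j - 1, h⟩ else 0

/-- The two servers lie in the same basic building element and differ in `a_0`. -/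
def SameBlock {n m k : ℕ} (u v : Server n m k) : Prop :=
  (∀ j, 1 ≤ j → j ≤ k → u.digit j = v.digit j) ∧ u.digit 0 ≠ v.digit 0

/-- Core servers that differ in exactly one digit, at a position `i ≥ 1`. -/
def CoreCore {n m k : ℕ} (u v : Server n m k) : Prop :=
  u.digit 0 < n ∧ ∃ i, 1 ≤ i ∧ i ≤ k ∧ u.digit i ≠ v.digit i ∧
    ∀ j, j ≤ k → j ≠ i → u.digit j = v.digit j

/-- The edge server `u` and the core server `v` share a switch of level `i ≥ 1`:
`u_i ⋯ u_1 = v_{i-1} ⋯ v_0`, and `u_j = v_j` for all `j > i`.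
(Then `v_0 = u_1 < n`, so `v` is a core server.) -/
def EdgeCore {n m k : ℕ} (u v : Server n m k) : Prop :=
  n ≤ u.digit 0 ∧ ∃ i, 1 ≤ i ∧ i ≤ k ∧
    (∀ j, 1 ≤ j → j ≤ i → u.digit j = v.digit (j - 1)) ∧
    (∀ j, i < j → j ≤ k → u.digit j = v.digit j)

/-- The logic graph `L-RCube(n,m,k)`. -/
def logicGraph (n m k : ℕ) : SimpleGraph (Server n m k) where
  Adj u v := SameBlock u v ∨ CoreCore u v ∨ EdgeCore u v ∨ EdgeCore v u
  symm := by
    constructor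
    rintro u v (h | ⟨h0, i, h1, hk, hne, h⟩ | h | h)
    · exact Or.inl ⟨fun j a b => (h.1 j a b).symm, h.2.symm⟩
    · refine Or.inr (Or.inl ⟨?_, i, h1, hk, hne.symm, fun j a b => (h j a b).symm⟩)
      rw [← h 0 (Nat.zero_le k) (by omega)]
      exact h0
    · exact Or.inr (Or.inr (Or.inr h))
    · exact Or.inr (Or.inr (Or.inl h))
  loopless := by
    have key : ∀ u : Server n m k, ¬ EdgeCore u u := by
      rintro u ⟨h0, i, h1, hk, h, -⟩
      have e := h 1 le_rfl h1
      have l : u.digit 1 < n := by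
        have h0k : 0 < k := by omega
        simp [Server.digit, h0k]
      simp only [Nat.sub_self] at e
      omega
    constructor
    rintro u (h | ⟨-, i, -, -, hne, -⟩ | h | h)
    · exact h.2 rfl
    · exact hne rfl
    · exact key u h
    · exact key u h

/-! ### Completely independent spanning trees -/

/-- The subgraphs `T i` of `G` (on all the vertices of `G`) are spanning trees of `G`, pairwise
edge-disjoint, and pairwise inner-vertex-disjoint: for all `x`, `y`, the paths joining `x` and `y`
in two of the trees have no common vertex except for `x` and `y`. -/
structure IsCIST {V ι : Type*} (G : SimpleGraph V) (T : ι → SimpleGraph V) : Prop where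
  subgraph : ∀ i, T i ≤ G
  isTree : ∀ i, (T i).IsTree
  edgeDisjoint : ∀ i j, i ≠ j → Disjoint (T i).edgeSet (T j).edgeSet
  innerDisjoint : ∀ i j, i ≠ j → ∀ (x y : V) (p : (T i).Path x y) (q : (T j).Path x y) (w : V),
    w ∈ p.1.support → w ∈ q.1.support → w = x ∨ w = y

/-! ### The cost model

Unit-cost word RAM: a word holds a parameter, an index or a server label, and each elementary
instruction on words (arithmetic, comparison, array access, creation of a list cell) is one step. -/

/-- A computation: its result and the number of steps it performs. -/
structure Timed (α : Type) where
  val : α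
  steps : ℕ

instance : Monad Timed where
  pure a := ⟨a, 0⟩
  bind x f := ⟨(f x.val).val, x.steps + (f x.val).steps⟩

/-- One elementary instruction with result `a`. -/
def op {α : Type} (a : α) : Timed α := ⟨a, 1⟩

/-- `c` iterations of a loop body, the counter starting at `i`. Each iteration costs one step for
the counter besides the cost of the body, and leaving the loop costs one step. -/
def loop {σ : Type} (body : ℕ → σ → Timed σ) : ℕ → ℕ → σ → Timed σ
  | 0, _, x => op x
  | c + 1, i, x => do
    let i' ← op (i + 1)
    let y ← body i x
    loop body c i' y

/-- `for i ← a to b do x ← body i x`, starting with the given `x`. -/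
def forLoop {σ : Type} (a b : ℕ) (x : σ) (body : ℕ → σ → Timed σ) : Timed σ :=
  loop body (b + 1 - a) a x

/-- A new array of `len` cells, indexed `1, …, len`. -/
def newArray {α : Type} (len : ℕ) (a : α) : Timed (ℕ → α) := ⟨fun _ => a, len + 1⟩

/-- Writing one cell of an array. -/
def write {α : Type} (A : ℕ → α) (i : ℕ) (a : α) : Timed (ℕ → α) := op (Function.update A i a)

/-- `n ^ e` by repeated multiplication. -/
def power (n e : ℕ) : Timed ℕ := forLoop 1 e 1 fun _ x => op (x * n)

/-! ### Edge sets as linked lists -/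

/-- The label `(q, j)` of a server: the basic building elements are numbered `q = 0, 1, …` and the
servers of each of them `j = 1, …, n + m`, both in lexicographic order of the addresses. -/
def Server.label {n m k : ℕ} (u : Server n m k) : ℕ × ℕ :=
  (∑ i : Fin k, (u.hi i : ℕ) * n ^ (i : ℕ), (u.lo : ℕ) + 1)

/-- A list cell, which takes a bounded number of words: either one edge, or all the edges that join
server `c` of element `q` to the servers `x ∈ [a, b]` of the same element (none if `b < a`). -/
inductive Item where
  | edge (u v : ℕ × ℕ)
  | star (q c a b : ℕ)
  deriving DecidableEq

/-- The edges that a cell stands for. -/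
def Item.edges : Item → Set (Sym2 (ℕ × ℕ))
  | .edge u v => {s(u, v)}
  | .star q c a b => {e | ∃ x, a ≤ x ∧ x ≤ b ∧ e = s((q, c), (q, x))}

/-- An edge set, stored as a linked list with pointers to both ends. -/
abbrev EdgeList := List Item

/-- The list stands for exactly the edges of the graph `T`. -/
def Represents {n m k : ℕ} (L : EdgeList) (T : SimpleGraph (Server n m k)) : Prop :=
  {e | ∃ x ∈ L, e ∈ x.edges} = Sym2.map Server.label '' T.edgeSet

/-- Adding a cell at the end. -/
def push (L : EdgeList) (x : Item) : Timed EdgeList := op (L ++ [x])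

/-- Destructive concatenation of two linked lists (neither operand is used afterwards). -/
def concat (L M : EdgeList) : Timed EdgeList := op (L ++ M)

/-- Deletion of a cell, found by scanning the list from its head, one step for each cell. -/
def remove (x : Item) : EdgeList → Timed EdgeList
  | [] => op []
  | y :: L => do
    let found ← op (decide (y = x))
    if found then pure L
    else do
      let L' ← remove x L
      pure (y :: L')

/-! ### The algorithms -/

/-- `⌊N/2⌋` trees in the complete graph on the servers `1, …, N` of element `q`; the `i`-th tree is
`{(i, i+s)} ∪ {(i, x) : x ∈ [i+1, s+i-1]} ∪ {(i+s, x) : x ∈ [1, i-1] ∪ [s+i+1, N]}` where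
`s = ⌊N/2⌋`. The result is the array of trees. -/
def completeTrees (N q : ℕ) : Timed (ℕ → EdgeList) := do
  let s ← op (N / 2)
  let T ← newArray s ([] : EdgeList)
  forLoop 1 s T fun i T => do
    let is ← op (i + s)
    let lo₁ ← op (i + 1)
    let hi₁ ← op (is - 1)
    let hi₂ ← op (i - 1)
    let lo₃ ← op (is + 1)
    let L ← push [] (.edge (q, i) (q, is))
    let L ← push L (.star q i lo₁ hi₁)
    let L ← push L (.star q is 1 hi₂)
    let L ← push L (.star q is lo₃ N)
    write T i L

/-- The number `t` of trees. -/
def treeCount (n m : ℕ) : Timed ℕ := do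
  let N ← op (n + m)
  let s ← op (N / 2)
  let one ← op (decide (n = 1))
  if one then pure s else op (min n s)

/-- The first element of the copy `H_i`, when the first element of `H_1` is `q` and each copy has
`w` elements. -/
def firstElement (q w i : ℕ) : Timed ℕ := do
  let i' ← op (i - 1)
  let d ← op (i' * w)
  op (q + d)

/-- The tree `T_j`, from the trees `H i j` of the copies `H_1, …, H_n` (as in `firstElement`).
With `v_{i,x}` the `x`-th server of the first element of `H_i`, it is
* for `m = 0`: `(⋃_i H i j) ∪ ⋃_{i ≥ 2} {(v_{1,j}, v_{i,j}), (v_{1,j+s}, v_{i,j+s})}` without the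
  edges `(v_{i,j}, v_{i,j+s})` for `i ≥ 2` (such an edge occurs in `H i j` only, and it is deleted
  from there before the union is formed);
* for `m > 0`: `(⋃_i H i j) ∪ ⋃_{i ≥ 2} {(v_{1,j}, v_{i,j})}`. -/
def joinTree (n m q w : ℕ) (H : ℕ → ℕ → EdgeList) (j : ℕ) : Timed EdgeList := do
  let N ← op (n + m)
  let s ← op (N / 2)
  let js ← op (j + s)
  let row ← op (H 1)
  let L ← op (row j)
  let noEdgeServers ← op (decide (m = 0))
  if noEdgeServers then
    forLoop 2 n L fun i L => do
      let r ← firstElement q w i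
      let row ← op (H i)
      let M ← op (row j)
      let M ← remove (.edge (r, j) (r, js)) M
      let L ← concat L M
      let L ← push L (.edge (q, j) (r, j))
      push L (.edge (q, js) (r, js))
  else
    forLoop 2 n L fun i L => do
      let r ← firstElement q w i
      let row ← op (H i)
      let M ← op (row j)
      let L ← concat L M
      push L (.edge (q, j) (r, j))

/-- The trees in the copy of `L-RCube(n,m,1)` that consists of the elements `q, …, q + n - 1`. The
result is the array of trees. -/
def baseTrees (n m q : ℕ) : Timed (ℕ → EdgeList) := do
  let t ← treeCount n m
  let H ← newArray n (fun _ : ℕ => ([] : EdgeList))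
  let H ← forLoop 1 n H fun i H => do
    let r ← firstElement q 1 i
    let N ← op (n + m)
    let A ← completeTrees N r
    write H i A
  let T ← newArray t ([] : EdgeList)
  forLoop 1 t T fun j T => do
    let one ← op (decide (n = 1))
    if one then do
      let row ← op (H 1)
      let L ← op (row j)
      write T j L
    else do
      let L ← joinTree n m q 1 H j
      write T j L

/-- The recursive algorithm on the copy of `L-RCube(n,m,k)`, `k ≥ 1`, whose first element is `q`
(the value for `k = 0` is irrelevant). The result is the array of trees. -/
def recTrees (n m : ℕ) : ℕ → ℕ → Timed (ℕ → EdgeList)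
  | 0, _ => newArray 0 []
  | k + 1, q => do
    let t ← treeCount n m
    let isBase ← op (decide (k + 1 = 1))
    let one ← op (decide (n = 1))
    if isBase || one then baseTrees n m q
    else do
      let k' ← op k
      let w ← power n k'
      let H ← newArray n (fun _ : ℕ => ([] : EdgeList))
      let H ← forLoop 1 n H fun i H => do
        let r ← firstElement q w i
        let A ← recTrees n m k r
        write H i A
      let T ← newArray t ([] : EdgeList)
      forLoop 1 t T fun j T => do
        let L ← joinTree n m q w H j
        write T j L

/-- The algorithm on `L-RCube(n,m,k)`: it returns the number `t` of trees and the array whose cells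
`1, …, t` hold the trees. -/
def cistAlgorithm (n m k : ℕ) : Timed (ℕ × (ℕ → EdgeList)) := do
  let t ← treeCount n m
  let T ← recTrees n m k 0
  pure (t, T)

end RCube

/-!
In element `q` the centres of the `j`-th tree are the servers `j` and `j + s`, where
`s = ⌊(n+m)/2⌋`. Every other vertex is a leaf hanging from one of the two centres of its own
element, and elements are attached to one another at centres only. Unrolling the recursion, element
`r ≠ 0` gets attached at exactly one level, namely that of its lowest nonzero digit in base `n`, and
it gets attached to the element in which this digit is cleared (`clearLowDigit`). So the `j`-th
tree is the graph of an explicit `parent` function on labels, under which a height decreases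
(`height_parent_lt`); it is therefore connected with fewer edges than vertices, that is, a tree
(`isTree_of_parent`). An inner vertex of a path has two neighbours in its tree and is thus a centre,
and the centres of different trees are disjoint; comparing parents excludes common edges
(`parentTree_isCIST`).

The algorithm maintains `IsTreeList`: the list of a tree on a copy starts with the edge between the
centres of the first element of the copy, and the rest of the list stands for the edges from the
vertices other than these two centres to their parents. When a copy other than the first is joined,
the first cell is deleted if `m = 0` and kept if `m > 0`; with the new edges, this gives the edges
from *all* vertices of the copy to their parents in the larger tree. As the deleted cell is always
at the head, each deletion takes one step, and joining the trees of `n` copies takes `O(t n)` steps.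
Results and step counts are tracked together by `Spec`; summing the cost of all levels of the
recursion gives `O(n ^ k (n + m))`.
-/

namespace RCube

/-! ### Trees given by a parent function -/

/-- A finite graph whose edges join each vertex other than `root` to its parent, where parents have
smaller rank, is a tree: it is connected by descent on the rank, and it has fewer edges than
vertices. -/
theorem isTree_of_parent {V : Type*} [Finite V] {G : SimpleGraph V} (root : V) (par : V → V)
    (rank : V → ℕ) (hadj : ∀ v, v ≠ root → G.Adj v (par v))
    (hrank : ∀ v, v ≠ root → rank (par v) < rank v)
    (hG : ∀ u v, G.Adj u v → (u ≠ root ∧ par u = v) ∨ (v ≠ root ∧ par v = u)) : G.IsTree := by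
  have hreach : ∀ r v, rank v = r → G.Reachable v root := by
    intro r
    induction r using Nat.strong_induction_on with
    | _ r ih =>
      rintro v rfl
      by_cases hv : v = root
      · rw [hv]
      · exact (hadj v hv).reachable.trans (ih _ (hrank v hv) _ rfl)
  have hconn : G.Connected :=
    { preconnected := fun u v => (hreach _ u rfl).trans (hreach _ v rfl).symm
      nonempty := ⟨root⟩ }
  rw [SimpleGraph.isTree_iff_connected_and_card]
  refine ⟨hconn, le_antisymm ?_ hconn.card_vert_le_card_edgeSet_add_one⟩
  have hsub : G.edgeSet ⊆ (fun v => s(v, par v)) '' {root}ᶜ := by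
    intro e
    induction e using Sym2.ind with
    | _ u v =>
      intro h
      rcases hG u v h with ⟨hu, rfl⟩ | ⟨hv, rfl⟩
      · exact ⟨u, hu, rfl⟩
      · exact ⟨v, hv, Sym2.eq_swap⟩
  have h1 : G.edgeSet.ncard ≤ ({root}ᶜ : Set V).ncard :=
    (Set.ncard_le_ncard hsub (Set.toFinite _)).trans (Set.ncard_image_le (Set.toFinite _))
  have h2 := Set.ncard_add_ncard_compl ({root} : Set V)
  rw [Set.ncard_singleton] at h2
  rw [Nat.card_coe_set_eq]
  omega

theorem exists_two_neighbors_of_mem_support {V : Type*} {G : SimpleGraph V} {x y w : V}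
    (p : G.Walk x y) (hp : p.IsPath) (hw : w ∈ p.support) (hx : w ≠ x) (hy : w ≠ y) :
    ∃ a b, a ≠ b ∧ G.Adj w a ∧ G.Adj w b := by
  induction p with
  | nil => simp_all
  | @cons u v z h p ih =>
    rw [SimpleGraph.Walk.cons_isPath_iff] at hp
    have hw' : w ∈ p.support := by simpa [hx] using hw
    by_cases hv : w = v
    · subst hv
      cases p with
      | nil => exact absurd rfl hy
      | @cons _ b _ h' p =>
        refine ⟨u, b, ?_, h.symm, h'⟩
        rintro rfl
        exact hp.2 (by simp)
    · exact ih hp.1 hw' hv hy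

/-! ### Clearing the lowest nonzero digit -/

/-- The number obtained from `q ≠ 0` by replacing its lowest nonzero digit in base `n` by `0`;
and `0` for `q = 0`. -/
noncomputable def clearLowDigit (n q : ℕ) : ℕ :=
  n ^ (multiplicity n q + 1) * (q / n ^ (multiplicity n q + 1))

theorem clearLowDigit_zero (n : ℕ) : clearLowDigit n 0 = 0 := by simp [clearLowDigit]

theorem clearLowDigit_eq {n i : ℕ} (l b : ℕ) (hi : 0 < i) (hin : i < n) :
    clearLowDigit n (n ^ l * (n * b + i)) = n ^ l * (n * b) := by
  have hn : 0 < n := by omega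
  have hm : multiplicity n (n ^ l * (n * b + i)) = l := by
    apply multiplicity_eq_of_dvd_of_not_dvd (Dvd.intro _ rfl)
    rw [pow_succ, Nat.mul_dvd_mul_iff_left (pow_pos hn l), Nat.dvd_add_right (Dvd.intro _ rfl)]
    exact Nat.not_dvd_of_pos_of_lt hi hin
  rw [clearLowDigit, hm, pow_succ, Nat.mul_div_mul_left _ _ (pow_pos hn l),
    Nat.mul_add_div hn, Nat.div_eq_of_lt hin, mul_assoc, add_zero]

theorem exists_lowDigit {n q : ℕ} (hn : 2 ≤ n) (hq : q ≠ 0) :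
    ∃ l b i, 0 < i ∧ i < n ∧ q = n ^ l * (n * b + i) ∧ clearLowDigit n q = n ^ l * (n * b) := by
  have hf : FiniteMultiplicity n q := Nat.finiteMultiplicity_iff.2 ⟨by omega, by omega⟩
  obtain ⟨c, hc, hnd⟩ := hf.exists_eq_pow_mul_and_not_dvd
  have hi : 0 < c % n := Nat.pos_of_ne_zero fun h => hnd (Nat.dvd_of_mod_eq_zero h)
  have hin : c % n < n := Nat.mod_lt _ (by omega)
  have hq' : q = n ^ multiplicity n q * (n * (c / n) + c % n) := by rwa [Nat.div_add_mod]
  refine ⟨_, _, _, hi, hin, hq', ?_⟩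
  conv_lhs => rw [hq']
  exact clearLowDigit_eq _ _ hi hin

theorem clearLowDigit_lt {n q : ℕ} (hn : 2 ≤ n) (hq : q ≠ 0) : clearLowDigit n q < q := by
  obtain ⟨l, b, i, hi, -, h1, h2⟩ := exists_lowDigit hn hq
  rw [h2]
  conv_rhs => rw [h1]
  exact Nat.mul_lt_mul_of_pos_left (by omega) (pow_pos (by omega) l)

theorem clearLowDigit_le (n q : ℕ) : clearLowDigit n q ≤ q := Nat.mul_div_le _ _

theorem pow_mul_div_pow_mod_eq {n l i X Y : ℕ} (hn : 0 < n) (hil : i ≠ l) (hXY : X / n = Y / n) :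
    n ^ l * X / n ^ i % n = n ^ l * Y / n ^ i % n := by
  rcases Nat.lt_or_gt_of_ne hil with h | h
  · obtain ⟨d, rfl⟩ := Nat.exists_eq_add_of_lt h
    have key : ∀ Z, n ^ (i + d + 1) * Z / n ^ i % n = 0 := by
      intro Z
      rw [show n ^ (i + d + 1) * Z = n ^ i * (n * (n ^ d * Z)) by ring,
        Nat.mul_div_cancel_left _ (pow_pos hn i), Nat.mul_mod_right]
    rw [key, key]
  · obtain ⟨d, rfl⟩ := Nat.exists_eq_add_of_lt h
    have key : ∀ Z, n ^ l * Z / n ^ (l + d + 1) = Z / n / n ^ d := by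
      intro Z
      rw [show n ^ (l + d + 1) = n ^ l * (n * n ^ d) by ring,
        Nat.mul_div_mul_left _ _ (pow_pos hn l), Nat.div_div_eq_div_mul]
    rw [key, key, hXY]

/-! ### Server labels -/

theorem label_fst {n m k : ℕ} (u : Server n m k) : u.label.1 = finFunctionFinEquiv u.hi := by
  rw [finFunctionFinEquiv_apply]
  rfl

theorem label_snd {n m k : ℕ} (u : Server n m k) : u.label.2 = u.lo + 1 := rfl

theorem label_injective {n m k : ℕ} : Function.Injective (Server.label (n := n) (m := m) (k := k)) := by
  intro u v h
  have h1 : u.label.1 = v.label.1 := by rw [h]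
  have h2 : u.label.2 = v.label.2 := by rw [h]
  rw [label_fst, label_fst] at h1
  have h3 := finFunctionFinEquiv.injective (Fin.ext h1)
  rw [label_snd, label_snd] at h2
  cases u
  cases v
  simp only [Server.mk.injEq]
  exact ⟨h3, Fin.ext (by simpa using h2)⟩

theorem exists_label_eq_iff {n m k : ℕ} {v : ℕ × ℕ} :
    (∃ u : Server n m k, u.label = v) ↔ v.1 < n ^ k ∧ 1 ≤ v.2 ∧ v.2 ≤ n + m := by
  constructor
  · rintro ⟨u, rfl⟩
    refine ⟨?_, ?_, ?_⟩
    · rw [label_fst]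
      exact Fin.isLt _
    · simp [label_snd]
    · rw [label_snd]
      exact u.lo.isLt
  · rintro ⟨h1, h2, h3⟩
    refine ⟨⟨finFunctionFinEquiv.symm ⟨v.1, h1⟩, ⟨v.2 - 1, by omega⟩⟩, Prod.ext ?_ ?_⟩
    · simp [label_fst]
    · simp only [label_snd]
      omega

instance {n m k : ℕ} : Finite (Server n m k) :=
  Finite.of_injective (fun u => (u.hi, u.lo)) fun u v h => by
    cases u
    cases v
    simpa using h

theorem hi_eq_of_label {n m k : ℕ} (u : Server n m k) (i : Fin k) :
    (u.hi i : ℕ) = u.label.1 / n ^ (i : ℕ) % n := by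
  have h := finFunctionFinEquiv_symm_apply_val (finFunctionFinEquiv u.hi) i
  rw [Equiv.symm_apply_apply] at h
  rw [h, label_fst]

theorem digit_zero {n m k : ℕ} (u : Server n m k) : u.digit 0 = u.label.2 - 1 := by
  simp [Server.digit, label_snd]

theorem digit_eq_of_label {n m k : ℕ} (u : Server n m k) {j : ℕ} (h1 : 1 ≤ j) (hk : j ≤ k) :
    u.digit j = u.label.1 / n ^ (j - 1) % n := by
  have h : j - 1 < k := by omega
  have h0 : j ≠ 0 := by omega
  simp only [Server.digit, h0, h, if_false, dif_pos]
  exact hi_eq_of_label u ⟨j - 1, h⟩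

theorem adj_of_label_fst_eq {n m k : ℕ} {u v : Server n m k} (h : u ≠ v)
    (h1 : u.label.1 = v.label.1) : (logicGraph n m k).Adj u v := by
  refine Or.inl ⟨fun j a b => by rw [digit_eq_of_label u a b, digit_eq_of_label v a b, h1],
    fun h0 => h (label_injective (Prod.ext h1 ?_))⟩
  simp only [digit_zero, label_snd] at h0 ⊢
  omega

/-- Core servers with the same last digit are adjacent if the element of one is obtained from the
element of the other by clearing the lowest nonzero digit. -/
theorem adj_of_label_fst_eq_clearLowDigit {n m k : ℕ} (hn : 2 ≤ n) {u v : Server n m k} (h : u ≠ v)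
    (h1 : clearLowDigit n u.label.1 = v.label.1) (h2 : u.label.2 = v.label.2)
    (hu : u.label.2 ≤ n) : (logicGraph n m k).Adj u v := by
  by_cases hq : u.label.1 = 0
  · rw [hq, clearLowDigit_zero] at h1
    exact absurd (label_injective (Prod.ext (hq.trans h1) h2)) h
  obtain ⟨l, b, i, hi, hin, e1, e2⟩ := exists_lowDigit hn hq
  have hpos : 1 ≤ u.label.2 := by simp [label_snd]
  have hdig : ∀ j, j ≤ k → j ≠ l + 1 → u.digit j = v.digit j := by
    intro j hj hjl
    rcases Nat.eq_zero_or_pos j with rfl | h0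
    · rw [digit_zero, digit_zero, h2]
    · rw [digit_eq_of_label u h0 hj, digit_eq_of_label v h0 hj, ← h1, e2, e1]
      apply pow_mul_div_pow_mod_eq (by omega) (by omega)
      rw [Nat.mul_add_div (by omega), Nat.div_eq_of_lt hin, Nat.mul_div_cancel_left _ (by omega),
        add_zero]
  have hne : ¬ ∀ j, j ≤ k → u.digit j = v.digit j := by
    intro hall
    apply h
    apply label_injective (Prod.ext _ h2)
    rw [label_fst, label_fst]
    congr 2
    funext i
    apply Fin.ext
    have := hall (i + 1) i.isLt
    simpa [Server.digit] using this
  push Not at hne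
  obtain ⟨j, hj, hjne⟩ := hne
  have hjl : j = l + 1 := by
    by_contra hcon
    exact hjne (hdig j hj hcon)
  subst hjl
  exact Or.inr (Or.inl ⟨by rw [digit_zero]; omega, l + 1, by omega, hj, hjne, hdig⟩)

/-! ### The trees -/

/-- The parent of the vertex labelled `(q, x)` in the `j`-th tree, rooted at `(0, j)`; the root is
its own parent. With `s = ⌊(n+m)/2⌋`, the centres of element `q` are `(q, j)` and `(q, j + s)`:
`(q, j)` hangs from `(q', j)`, where `q'` is `q` with its lowest nonzero digit cleared; `(q, j + s)`
hangs from `(q', j + s)` if there are no edge servers and `q ≠ 0`, and from `(q, j)` otherwise.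
Every other vertex hangs from a centre of its own element. -/
noncomputable def parent (n m j : ℕ) (v : ℕ × ℕ) : ℕ × ℕ :=
  if v.2 = j then (clearLowDigit n v.1, j)
  else if v.2 = j + (n + m) / 2 then
    if m = 0 ∧ v.1 ≠ 0 then (clearLowDigit n v.1, j + (n + m) / 2) else (v.1, j)
  else if j < v.2 ∧ v.2 < j + (n + m) / 2 then (v.1, j)
  else (v.1, j + (n + m) / 2)

theorem parent_snd (n m j : ℕ) (v : ℕ × ℕ) :
    (parent n m j v).2 = j ∨ (parent n m j v).2 = j + (n + m) / 2 := by
  unfold parent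
  split_ifs <;> simp

theorem parent_fst_le (n m j : ℕ) (v : ℕ × ℕ) : (parent n m j v).1 ≤ v.1 := by
  have := clearLowDigit_le n v.1
  unfold parent
  split_ifs <;> simp [this]

theorem parent_snd_of_not_centre {n m j : ℕ} {v : ℕ × ℕ} (h1 : v.2 ≠ j)
    (h2 : v.2 ≠ j + (n + m) / 2) :
    (j < v.2 ∧ v.2 < j + (n + m) / 2 ∧ (parent n m j v).2 = j) ∨
      (¬ (j < v.2 ∧ v.2 < j + (n + m) / 2) ∧ (parent n m j v).2 = j + (n + m) / 2) := by
  unfold parent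
  rw [if_neg h1, if_neg h2]
  split_ifs with h
  · exact Or.inl ⟨h.1, h.2, rfl⟩
  · exact Or.inr ⟨h, rfl⟩

/-- The height used to compare a vertex with its parent in the `j`-th tree: elements in their
order, and in each element the first centre, then the second, then the other vertices. -/
def height (n m j : ℕ) (v : ℕ × ℕ) : ℕ :=
  3 * v.1 + if v.2 = j then 0 else if v.2 = j + (n + m) / 2 then 1 else 2

theorem height_parent_lt {n m j : ℕ} {v : ℕ × ℕ} (hs : 0 < (n + m) / 2)
    (hn : v.1 ≠ 0 → 2 ≤ n) (hv : v ≠ (0, j)) :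
    height n m j (parent n m j v) < height n m j v := by
  obtain ⟨q, x⟩ := v
  have hclear : q ≠ 0 → clearLowDigit n q < q := fun h => clearLowDigit_lt (hn h) h
  have hne : x = j → q ≠ 0 := by
    rintro rfl rfl
    exact hv rfl
  have hs' : (n + m) / 2 ≠ 0 := by omega
  unfold height parent
  dsimp only
  (split_ifs <;> simp_all); omega

/-- The `j`-th tree as a graph on the servers. -/
noncomputable def parentTree (n m k j : ℕ) : SimpleGraph (Server n m k) :=
  SimpleGraph.fromRel fun u v => parent n m j u.label = v.label

theorem parentTree_adj {n m k j : ℕ} {u v : Server n m k} : (parentTree n m k j).Adj u v ↔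
    u ≠ v ∧ (parent n m j u.label = v.label ∨ parent n m j v.label = u.label) :=
  SimpleGraph.fromRel_adj _ _ _

theorem exists_label_eq_parent {n m k j : ℕ} (hj : 1 ≤ j) (hjs : j ≤ (n + m) / 2)
    (u : Server n m k) : ∃ v : Server n m k, v.label = parent n m j u.label := by
  rw [exists_label_eq_iff]
  have h1 := (exists_label_eq_iff.1 ⟨u, rfl⟩ : u.label.1 < n ^ k ∧ _)
  have h2 := parent_fst_le n m j u.label
  have h3 := parent_snd n m j u.label
  omega

theorem two_le_of_label_ne_zero {n m k : ℕ} (hn : 1 ≤ n) (u : Server n m k) (h : u.label.1 ≠ 0) :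
    2 ≤ n := by
  have h1 := (exists_label_eq_iff.1 ⟨u, rfl⟩ : u.label.1 < n ^ k ∧ _).1
  by_contra hcon
  obtain rfl : n = 1 := by omega
  rw [one_pow] at h1
  omega

theorem parentTree_isTree {n m k j : ℕ} (hn : 1 ≤ n) (hj : 1 ≤ j) (hjs : j ≤ (n + m) / 2) :
    (parentTree n m k j).IsTree := by
  choose par hpar using fun u : Server n m k => exists_label_eq_parent (k := k) hj hjs u
  obtain ⟨root, hroot⟩ : ∃ u : Server n m k, u.label = (0, j) :=
    exists_label_eq_iff.2 ⟨pow_pos hn k, hj, by dsimp only; omega⟩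
  have hlt : ∀ u, u ≠ root → height n m j (par u).label < height n m j u.label := by
    intro u hu
    rw [hpar]
    refine height_parent_lt (by omega) (two_le_of_label_ne_zero hn u) fun h => hu ?_
    exact label_injective (h.trans hroot.symm)
  have hpr : par root = root := by
    apply label_injective
    rw [hpar, hroot]
    simp [parent, clearLowDigit_zero]
  refine isTree_of_parent root par (fun u => height n m j u.label) ?_ hlt ?_
  · intro u hu
    refine parentTree_adj.2 ⟨fun h => ?_, Or.inl (hpar u).symm⟩
    have := hlt u hu
    rw [← h] at this
    exact lt_irrefl _ this
  · intro u v h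
    obtain ⟨hne, h | h⟩ := parentTree_adj.1 h
    · rw [← hpar] at h
      have h := label_injective h
      refine Or.inl ⟨?_, h⟩
      rintro rfl
      exact hne (hpr ▸ h)
    · rw [← hpar] at h
      have h := label_injective h
      refine Or.inr ⟨?_, h⟩
      rintro rfl
      exact hne (hpr ▸ h).symm

theorem adj_of_parent_eq {n m k j : ℕ} (hn : 1 ≤ n) (hjs : j ≤ (n + m) / 2)
    (hjn : n = 1 ∨ j ≤ n) {u v : Server n m k} (hne : u ≠ v)
    (h : parent n m j u.label = v.label) : (logicGraph n m k).Adj u v := by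
  by_cases h1 : u.label.1 = v.label.1
  · exact adj_of_label_fst_eq hne h1
  have h0 : u.label.1 ≠ 0 := by
    have := parent_fst_le n m j u.label
    rw [h] at this
    omega
  have hn2 := two_le_of_label_ne_zero hn u h0
  have hf := congrArg Prod.fst h
  have hs := congrArg Prod.snd h
  unfold parent at hf hs
  split_ifs at hf hs with a b c d
  · exact adj_of_label_fst_eq_clearLowDigit hn2 hne hf (a.trans hs) (by omega)
  · exact adj_of_label_fst_eq_clearLowDigit hn2 hne hf (b.trans hs) (by omega)
  all_goals exact absurd hf h1

theorem parentTree_le {n m k j : ℕ} (hn : 1 ≤ n) (hjs : j ≤ (n + m) / 2)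
    (hjn : n = 1 ∨ j ≤ n) : parentTree n m k j ≤ logicGraph n m k := by
  intro u v h
  obtain ⟨hne, h | h⟩ := parentTree_adj.1 h
  · exact adj_of_parent_eq hn hjs hjn hne h
  · exact (adj_of_parent_eq hn hjs hjn hne.symm h).symm

/-- A vertex with two neighbours in the `j`-th tree is a centre: any other vertex is nobody's
parent. -/
theorem centre_of_two_neighbors {n m k j : ℕ} {w a b : Server n m k} (hab : a ≠ b)
    (ha : (parentTree n m k j).Adj w a) (hb : (parentTree n m k j).Adj w b) :
    w.label.2 = j ∨ w.label.2 = j + (n + m) / 2 := by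
  have ha := (parentTree_adj.1 ha).2
  have hb := (parentTree_adj.1 hb).2
  rcases ha with ha | ha
  · rcases hb with hb | hb
    · exact absurd (label_injective (ha.symm.trans hb)) hab
    · exact hb ▸ parent_snd n m j _
  · exact ha ▸ parent_snd n m j _

theorem not_common_parent_edge {n m i j : ℕ} (hi : 1 ≤ i) (his : i ≤ (n + m) / 2)
    (hj : 1 ≤ j) (hjs : j ≤ (n + m) / 2) (hij : i ≠ j) {a b : ℕ × ℕ} (h1 : parent n m i a = b)
    (h2 : parent n m j a = b ∨ parent n m j b = a) : False := by
  have hb := parent_snd n m i a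
  rw [h1] at hb
  rcases h2 with h2 | h2
  · have hb' := parent_snd n m j a
    rw [h2] at hb'
    omega
  · have ha := parent_snd n m j b
    rw [h2] at ha
    have e1 := parent_snd_of_not_centre (n := n) (m := m) (j := i) (v := a) (by omega) (by omega)
    have e2 := parent_snd_of_not_centre (n := n) (m := m) (j := j) (v := b) (by omega) (by omega)
    rw [h1] at e1
    rw [h2] at e2
    omega

theorem parentTree_isCIST {n m k t : ℕ} (hn : 1 ≤ n) (hts : t ≤ (n + m) / 2)
    (htn : n = 1 ∨ t ≤ n) :
    IsCIST (logicGraph n m k) fun j : Fin t => parentTree n m k (j + 1) where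
  subgraph j := parentTree_le hn (by omega) (by omega)
  isTree j := parentTree_isTree hn (by omega) (by omega)
  edgeDisjoint i j hij := by
    have hij' : (i : ℕ) + 1 ≠ j + 1 := fun h => hij (Fin.ext (by omega))
    rw [Set.disjoint_left]
    intro e
    induction e using Sym2.ind with
    | _ u v =>
      intro h1 h2
      have h1 := (parentTree_adj.1 h1).2
      have h2 := (parentTree_adj.1 h2).2
      rcases h1 with h1 | h1
      · exact not_common_parent_edge (by omega) (by omega) (by omega) (by omega) hij' h1 h2
      · exact not_common_parent_edge (by omega) (by omega) (by omega) (by omega) hij' h1 h2.symm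
  innerDisjoint i j hij x y p q w hp hq := by
    have hij' : (i : ℕ) ≠ j := fun h => hij (Fin.ext h)
    by_contra hcon
    push Not at hcon
    obtain ⟨a, b, hab, ha, hb⟩ :=
      exists_two_neighbors_of_mem_support p.1 p.2 hp hcon.1 hcon.2
    obtain ⟨c, d, hcd, hc, hd⟩ :=
      exists_two_neighbors_of_mem_support q.1 q.2 hq hcon.1 hcon.2
    have h1 := centre_of_two_neighbors hab ha hb
    have h2 := centre_of_two_neighbors hcd hc hd
    omega

/-! ### Edge lists of the trees -/

/-- The edges that the cells of a list stand for. -/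
def edgesOf (L : EdgeList) : Set (Sym2 (ℕ × ℕ)) := {e | ∃ x ∈ L, e ∈ x.edges}

theorem edgesOf_append (L M : EdgeList) : edgesOf (L ++ M) = edgesOf L ∪ edgesOf M := by
  ext e
  simp [edgesOf, or_and_right, exists_or]

theorem edgesOf_cons (x : Item) (L : EdgeList) : edgesOf (x :: L) = x.edges ∪ edgesOf L := by
  ext e
  simp [edgesOf]

theorem edgesOf_nil : edgesOf [] = ∅ := by
  ext e
  simp [edgesOf]

/-- The edge from a vertex to its parent in the `j`-th tree. -/
noncomputable def parentEdge (n m j : ℕ) (v : ℕ × ℕ) : Sym2 (ℕ × ℕ) := s(v, parent n m j v)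

/-- The vertices of the elements `q, …, q + c - 1` besides the two centres of element `q`. -/
def lowerVertices (n m j q c : ℕ) : Set (ℕ × ℕ) :=
  {v | q ≤ v.1 ∧ v.1 < q + c ∧ 1 ≤ v.2 ∧ v.2 ≤ n + m ∧
    v ≠ (q, j) ∧ v ≠ (q, j + (n + m) / 2)}

/-- The list stands for the `j`-th tree on the elements `q, …, q + c - 1`, in which element `q`
plays the role of the root element: the edge between the centres of `q` comes first, where it is
found in one step when it has to be deleted, and all other vertices follow with the edges to their
parents. -/
def IsTreeList (n m j q c : ℕ) (L : EdgeList) : Prop :=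
  ∃ M, L = .edge (q, j) (q, j + (n + m) / 2) :: M ∧
    edgesOf M = parentEdge n m j '' lowerVertices n m j q c

theorem lowerVertices_add {n m j q c w : ℕ} (hj : 1 ≤ j) (hjs : j ≤ (n + m) / 2) (hc : 0 < c)
    (hw : 0 < w) : lowerVertices n m j q (c + w) = lowerVertices n m j q c ∪
      (lowerVertices n m j (q + c) w ∪ {(q + c, j), (q + c, j + (n + m) / 2)}) := by
  ext ⟨r, x⟩
  simp only [lowerVertices, Set.mem_ofPred_eq, Set.mem_union, Set.mem_insert_iff,
    Set.mem_singleton_iff, Prod.mk.injEq, ne_eq]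
  omega

/-- The four cells that make up the `j`-th tree of element `q`. -/
theorem isTreeList_one {n m j q : ℕ} (hj : 1 ≤ j) (hjs : j ≤ (n + m) / 2) :
    IsTreeList n m j q 1 [.edge (q, j) (q, j + (n + m) / 2),
      .star q j (j + 1) (j + (n + m) / 2 - 1), .star q (j + (n + m) / 2) 1 (j - 1),
      .star q (j + (n + m) / 2) (j + (n + m) / 2 + 1) (n + m)] := by
  refine ⟨_, rfl, ?_⟩
  simp only [edgesOf_cons, edgesOf_nil, Set.union_empty, Item.edges]
  have key : ∀ x, x ≠ j → x ≠ j + (n + m) / 2 → parentEdge n m j (q, x) =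
      if j < x ∧ x < j + (n + m) / 2 then s((q, j), (q, x))
      else s((q, j + (n + m) / 2), (q, x)) := by
    intro x h1 h2
    simp only [parentEdge, parent, if_neg h1, if_neg h2]
    split_ifs <;> rw [Sym2.eq_swap]
  ext e
  constructor
  · rintro (⟨x, h1, h2, rfl⟩ | ⟨x, h1, h2, rfl⟩ | ⟨x, h1, h2, rfl⟩)
    · refine ⟨(q, x), ?_, by rw [key x (by omega) (by omega), if_pos (by omega)]⟩
      simp only [lowerVertices, Set.mem_ofPred_eq, Prod.mk.injEq, ne_eq]
      omega
    · refine ⟨(q, x), ?_, by rw [key x (by omega) (by omega), if_neg (by omega)]⟩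
      simp only [lowerVertices, Set.mem_ofPred_eq, Prod.mk.injEq, ne_eq]
      omega
    · refine ⟨(q, x), ?_, by rw [key x (by omega) (by omega), if_neg (by omega)]⟩
      simp only [lowerVertices, Set.mem_ofPred_eq, Prod.mk.injEq, ne_eq]
      omega
  · rintro ⟨⟨r, x⟩, h, rfl⟩
    simp only [lowerVertices, Set.mem_ofPred_eq, Prod.mk.injEq, ne_eq] at h
    obtain rfl : r = q := by omega
    rw [key x (by omega) (by omega)]
    split_ifs with hx
    · exact Or.inl ⟨x, by omega, by omega, rfl⟩
    · by_cases hxj : x < j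
      · exact Or.inr (Or.inl ⟨x, by omega, by omega, rfl⟩)
      · exact Or.inr (Or.inr ⟨x, by omega, by omega, rfl⟩)

/-- A list for `c` elements is extended by the next `w` elements, whose root element `q + c` is to
be attached to element `q`. -/
theorem IsTreeList.append {n m j q c w : ℕ} (hj : 1 ≤ j) (hjs : j ≤ (n + m) / 2) (hc : 0 < c)
    (hw : 0 < w) {L A : EdgeList} (hL : IsTreeList n m j q c L)
    (hA : edgesOf A = parentEdge n m j ''
      (lowerVertices n m j (q + c) w ∪ {(q + c, j), (q + c, j + (n + m) / 2)})) :
    IsTreeList n m j q (c + w) (L ++ A) := by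
  obtain ⟨M, rfl, hM⟩ := hL
  refine ⟨M ++ A, rfl, ?_⟩
  rw [edgesOf_append, hM, hA, lowerVertices_add hj hjs hc hw]
  exact (Set.image_union _ _ _).symm

theorem represents_parentTree {n m k j : ℕ} (hn : 1 ≤ n) (hj : 1 ≤ j) (hjs : j ≤ (n + m) / 2)
    {L : EdgeList} (hL : IsTreeList n m j 0 (n ^ k) L) :
    Represents L (parentTree n m k j) := by
  obtain ⟨M, rfl, hM⟩ := hL
  have hs : (n + m) / 2 ≠ 0 := by omega
  have hpow : 0 < n ^ k := pow_pos hn k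
  -- The first cell is the edge from the second centre of element `0` to its parent.
  have hE : edgesOf (.edge (0, j) (0, j + (n + m) / 2) :: M) =
      parentEdge n m j '' {v | v.1 < n ^ k ∧ 1 ≤ v.2 ∧ v.2 ≤ n + m ∧ v ≠ (0, j)} := by
    have h1 : {v : ℕ × ℕ | v.1 < n ^ k ∧ 1 ≤ v.2 ∧ v.2 ≤ n + m ∧ v ≠ (0, j)} =
        {(0, j + (n + m) / 2)} ∪ lowerVertices n m j 0 (n ^ k) := by
      ext ⟨r, x⟩
      simp only [lowerVertices, Set.mem_ofPred_eq, Set.mem_union,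
        Set.mem_singleton_iff, Prod.mk.injEq, ne_eq]
      omega
    have h2 : parentEdge n m j (0, j + (n + m) / 2) = s((0, j), (0, j + (n + m) / 2)) := by
      simp [parentEdge, parent, hs, Sym2.eq_swap]
    rw [edgesOf_cons, hM, h1, Set.image_union, Set.image_singleton, h2]
    rfl
  refine hE.trans ?_
  ext e
  constructor
  · rintro ⟨v, ⟨h1, h2, h3, h4⟩, rfl⟩
    obtain ⟨u, rfl⟩ := (exists_label_eq_iff (n := n) (m := m) (k := k)).2 ⟨h1, h2, h3⟩
    obtain ⟨w, hw⟩ := exists_label_eq_parent hj hjs u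
    refine ⟨s(u, w), parentTree_adj.2 ⟨?_, Or.inl hw.symm⟩, ?_⟩
    · intro (h : u = w)
      subst h
      have := height_parent_lt (m := m) (by omega) (two_le_of_label_ne_zero hn u) h4
      rw [← hw] at this
      exact lt_irrefl _ this
    · rw [Sym2.map_mk, parentEdge, ← hw]
  · have key : ∀ u v : Server n m k, u ≠ v → parent n m j u.label = v.label →
        s(u.label, v.label) ∈ parentEdge n m j ''
          {v | v.1 < n ^ k ∧ 1 ≤ v.2 ∧ v.2 ≤ n + m ∧ v ≠ (0, j)} := by
      intro u v hne h
      obtain ⟨h1, h2, h3⟩ := exists_label_eq_iff.1 ⟨u, rfl⟩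
      refine ⟨u.label, ⟨h1, h2, h3, fun h4 => hne (label_injective ?_)⟩, by rw [parentEdge, h]⟩
      rw [← h, h4]
      simp [parent, clearLowDigit_zero]
    rintro ⟨e, he, rfl⟩
    induction e using Sym2.ind with
    | _ u v =>
      rw [Sym2.map_mk]
      obtain ⟨hne, h | h⟩ := parentTree_adj.1 he
      · exact key u v hne h
      · rw [Sym2.eq_swap]
        exact key v u hne.symm h

/-! ### Specifications of timed computations -/

/-- The result of `x` satisfies `Q`, and `x` performs at most `B` steps. -/
def Spec {α : Type} (x : Timed α) (Q : α → Prop) (B : ℕ) : Prop := Q x.val ∧ x.steps ≤ B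

section Spec

variable {α β σ : Type}

theorem Spec.mono {x : Timed α} {Q Q' : α → Prop} {B B' : ℕ} (h : Spec x Q B) (hB : B ≤ B')
    (hQ : ∀ a, Q a → Q' a) : Spec x Q' B' :=
  ⟨hQ _ h.1, h.2.trans hB⟩

theorem Spec.bind {x : Timed α} {f : α → Timed β} {P : α → Prop} {Q : β → Prop} {B B' : ℕ}
    (h : Spec x P B) (hf : ∀ a, P a → Spec (f a) Q B') : Spec (x >>= f) Q (B + B') :=
  ⟨(hf _ h.1).1, Nat.add_le_add h.2 (hf _ h.1).2⟩

theorem Spec.weaken {x : Timed α} {Q : α → Prop} {B B' : ℕ} (h : Spec x Q B) (hB : B ≤ B') :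
    Spec x Q B' :=
  h.mono hB fun _ h => h

theorem Spec.bind_eq {x : Timed α} {a : α} {f : α → Timed β} {Q : β → Prop} {B B' : ℕ}
    (h : Spec x (· = a) B) (hf : Spec (f a) Q B') : Spec (x >>= f) Q (B + B') :=
  h.bind (by rintro _ rfl; exact hf)

theorem Spec.pure {a : α} {Q : α → Prop} (h : Q a) : Spec (pure a : Timed α) Q 0 := ⟨h, le_rfl⟩

theorem Spec.op {a : α} {Q : α → Prop} (h : Q a) : Spec (op a) Q 1 := ⟨h, le_rfl⟩

theorem Spec.op_bind {a : α} {f : α → Timed β} {Q : β → Prop} {B : ℕ} (h : Spec (f a) Q B) :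
    Spec (RCube.op a >>= f) Q (B + 1) :=
  (Spec.bind_eq (Spec.op rfl) h).weaken (Nat.add_comm 1 B).le

theorem Spec.newArray_bind {len : ℕ} {a : α} {f : (ℕ → α) → Timed β} {Q : β → Prop} {B : ℕ}
    (h : Spec (f fun _ => a) Q B) : Spec (newArray len a >>= f) Q (len + 1 + B) :=
  Spec.bind_eq ⟨rfl, le_rfl⟩ h

/-- Invariant rule for loops. -/
theorem loop_spec {body : ℕ → σ → Timed σ} (Inv : ℕ → σ → Prop) (B : ℕ) :
    ∀ (c i : ℕ) (x : σ), Inv i x →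
      (∀ i' y, i ≤ i' → i' < i + c → Inv i' y → Spec (body i' y) (Inv (i' + 1)) B) →
      Spec (loop body c i x) (Inv (i + c)) (c * (B + 1) + 1)
  | 0, _, _, h0, _ => ⟨h0, by simp [loop, RCube.op]⟩
  | c + 1, i, x, h0, hs => by
    refine Spec.mono (Spec.op_bind (Spec.bind (hs i x le_rfl (by omega) h0) fun y hy =>
      loop_spec Inv B c (i + 1) y hy fun i' z h1 h2 => hs i' z (by omega) (by omega)))
      (by rw [Nat.succ_mul]; omega) fun z hz => ?_
    rwa [show i + (c + 1) = i + 1 + c by omega]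

theorem forLoop_spec {body : ℕ → σ → Timed σ} {a b : ℕ} {x : σ} (Inv : ℕ → σ → Prop) (B : ℕ)
    (hab : a ≤ b + 1) (h0 : Inv a x)
    (hs : ∀ i y, a ≤ i → i ≤ b → Inv i y → Spec (body i y) (Inv (i + 1)) B) :
    Spec (forLoop a b x body) (Inv (b + 1)) ((b + 1 - a) * (B + 1) + 1) := by
  have := loop_spec (body := body) Inv B (b + 1 - a) a x h0
    fun i y h1 h2 => hs i y h1 (by omega)
  rwa [show a + (b + 1 - a) = b + 1 by omega] at this

/-- A loop that fills the cells `1, …, c` of an array, one in each iteration. -/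
theorem forLoop_fill_spec {body : ℕ → (ℕ → α) → Timed (ℕ → α)} {c : ℕ} {A : ℕ → α}
    (R : ℕ → α → Prop) (B : ℕ)
    (hs : ∀ i A, 1 ≤ i → i ≤ c →
      Spec (body i A) (fun A' => ∃ a, A' = Function.update A i a ∧ R i a) B) :
    Spec (forLoop 1 c A body) (fun A' => ∀ i, 1 ≤ i → i ≤ c → R i (A' i)) (c * (B + 1) + 1) := by
  refine Spec.mono (forLoop_spec (fun i A => ∀ i', 1 ≤ i' → i' < i → R i' (A i')) B (by omega)
    (fun i' _ _ => by omega) fun i A h1 h2 hA => ?_) (by simp) fun A hA i h1 h2 =>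
      hA i h1 (by omega)
  refine Spec.mono (hs i A h1 h2) le_rfl ?_
  rintro _ ⟨a, rfl, ha⟩ i' h3 h4
  by_cases h : i' = i
  · subst h
    rwa [Function.update_self]
  · rw [Function.update_of_ne h]
    exact hA i' h3 (by omega)

end Spec

theorem power_spec (n e : ℕ) : Spec (power n e) (· = n ^ e) (2 * e + 1) := by
  refine Spec.mono (forLoop_spec (fun i x => x = n ^ (i - 1)) 1 (by omega) rfl ?_)
    (by omega) fun _ h => h
  rintro i _ h1 - rfl
  refine Spec.op ?_
  rw [← pow_succ, Nat.sub_add_cancel h1, Nat.add_sub_cancel]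

theorem remove_head_spec (x : Item) (L : EdgeList) : Spec (remove x (x :: L)) (· = L) 1 := by
  refine Spec.mono (Spec.op_bind (B := 0) ?_) le_rfl fun _ h => h
  rw [if_pos (by simp)]
  exact Spec.pure rfl

theorem firstElement_spec (q w i : ℕ) : Spec (firstElement q w i) (· = q + (i - 1) * w) 3 :=
  Spec.op_bind (B := 2) (Spec.op_bind (B := 1) (Spec.op rfl))

theorem treeCount_spec {n m t : ℕ} (ht : t = if n = 1 then (n + m) / 2 else min n ((n + m) / 2)) :
    Spec (treeCount n m) (· = t) 4 := by
  subst ht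
  unfold treeCount
  iterate 3 apply Spec.op_bind
  by_cases h : n = 1
  · simp only [h, decide_true, if_true]
    exact (Spec.pure rfl).weaken (by omega)
  · simp only [h, decide_false, if_false, Bool.false_eq_true]
    exact Spec.op rfl

/-! ### Correctness and cost of the algorithms -/

theorem completeTrees_spec (n m q : ℕ) :
    Spec (completeTrees (n + m) q)
      (fun A => ∀ j, 1 ≤ j → j ≤ (n + m) / 2 → IsTreeList n m j q 1 (A j))
      (6 * (n + m) + 3) := by
  apply Spec.weaken
  · unfold completeTrees
    apply Spec.op_bind
    apply Spec.newArray_bind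
    apply forLoop_fill_spec (fun j L => IsTreeList n m j q 1 L) 10
    intro j A h1 h2
    iterate 5 apply Spec.op_bind
    iterate 4 apply Spec.op_bind
    exact Spec.op ⟨_, rfl, isTreeList_one h1 h2⟩
  · omega

/-- Joining the trees of `n` copies, of `w = n ^ k` elements each. The edge to be deleted from the
tree of a copy is at the head of its list, so that an iteration takes a bounded number of steps. -/
theorem joinTree_spec {n m k q j : ℕ} {H : ℕ → ℕ → EdgeList} (hn : 1 ≤ n) (hj : 1 ≤ j)
    (hjs : j ≤ (n + m) / 2) (hq : n ^ (k + 1) ∣ q)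
    (hH : ∀ i, 1 ≤ i → i ≤ n → IsTreeList n m j (q + (i - 1) * n ^ k) (n ^ k) (H i j)) :
    Spec (joinTree n m q (n ^ k) H j) (IsTreeList n m j q (n ^ (k + 1))) (10 * n + 7) := by
  have hw : 0 < n ^ k := pow_pos hn k
  obtain ⟨b, rfl⟩ := hq
  have hclear : ∀ i, 2 ≤ i → i ≤ n →
      clearLowDigit n (n ^ (k + 1) * b + (i - 1) * n ^ k) = n ^ (k + 1) * b := by
    intro i h1 h2
    rw [show n ^ (k + 1) * b + (i - 1) * n ^ k = n ^ k * (n * b + (i - 1)) by ring,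
      clearLowDigit_eq k b (by omega) (by omega)]
    ring
  have hne : ∀ i, 2 ≤ i → n ^ (k + 1) * b + (i - 1) * n ^ k ≠ 0 := by
    intro i h1
    have : 0 < (i - 1) * n ^ k := Nat.mul_pos (by omega) hw
    omega
  have hs : (n + m) / 2 ≠ 0 := by omega
  have hj1 : ∀ i, 2 ≤ i → i ≤ n → parentEdge n m j (n ^ (k + 1) * b + (i - 1) * n ^ k, j) =
      s((n ^ (k + 1) * b, j), (n ^ (k + 1) * b + (i - 1) * n ^ k, j)) := by
    intro i h1 h2
    simp [parentEdge, parent, hclear i h1 h2, Sym2.eq_swap]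
  -- After the iterations for `2, …, i - 1`, the list covers `i - 1` copies.
  have hstep : ∀ i L A, 2 ≤ i →
      IsTreeList n m j (n ^ (k + 1) * b) ((i - 1) * n ^ k) L →
      edgesOf A = parentEdge n m j '' (lowerVertices n m j
        (n ^ (k + 1) * b + (i - 1) * n ^ k) (n ^ k) ∪
          {(n ^ (k + 1) * b + (i - 1) * n ^ k, j),
            (n ^ (k + 1) * b + (i - 1) * n ^ k, j + (n + m) / 2)}) →
      IsTreeList n m j (n ^ (k + 1) * b) ((i + 1 - 1) * n ^ k) (L ++ A) := by
    intro i L A h1 hL hA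
    rw [show (i + 1 - 1) * n ^ k = (i - 1) * n ^ k + n ^ k by
      rw [← Nat.succ_mul]; congr 1; omega]
    exact hL.append hj hjs (Nat.mul_pos (by omega) hw) hw hA
  have h0 : IsTreeList n m j (n ^ (k + 1) * b) ((2 - 1) * n ^ k) (H 1 j) := by
    simpa using hH 1 le_rfl hn
  have hfin : n ^ (k + 1) = (n + 1 - 1) * n ^ k := by
    rw [Nat.add_sub_cancel, pow_succ, mul_comm]
  apply Spec.weaken
  · unfold joinTree
    iterate 6 apply Spec.op_bind
    have hloop : ∀ body : ℕ → EdgeList → Timed EdgeList,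
        (∀ i L, 2 ≤ i → i ≤ n → IsTreeList n m j (n ^ (k + 1) * b) ((i - 1) * n ^ k) L →
          Spec (body i L) (IsTreeList n m j (n ^ (k + 1) * b) ((i + 1 - 1) * n ^ k)) 9) →
        Spec (forLoop 2 n (H 1 j) body) (IsTreeList n m j (n ^ (k + 1) * b) (n ^ (k + 1)))
          ((n + 1 - 2) * (9 + 1) + 1) := by
      intro body hbody
      refine Spec.mono (forLoop_spec
        (fun i L => IsTreeList n m j (n ^ (k + 1) * b) ((i - 1) * n ^ k) L) 9 (by omega) h0 hbody)
        le_rfl fun L h => ?_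
      rw [hfin]
      rwa [hfin] at h
    by_cases hm : m = 0
    · simp only [hm, decide_true, if_true]
      rw [hm] at hloop
      apply hloop
      subst hm
      intro i L h1 h2 hL
      refine Spec.bind_eq (firstElement_spec _ _ i) (B' := 6) ?_
      iterate 2 apply Spec.op_bind
      obtain ⟨M, hM, hME⟩ := hH i (by omega) h2
      rw [hM]
      refine Spec.bind_eq (remove_head_spec _ M) (B' := 3) ?_
      iterate 2 apply Spec.op_bind
      apply Spec.op
      rw [List.append_assoc, List.append_assoc]
      refine hstep i L _ h1 hL ?_
      have hj2 : parentEdge n 0 j (n ^ (k + 1) * b + (i - 1) * n ^ k, j + (n + 0) / 2) =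
          s((n ^ (k + 1) * b, j + (n + 0) / 2),
            (n ^ (k + 1) * b + (i - 1) * n ^ k, j + (n + 0) / 2)) := by
        rw [parentEdge, parent, if_neg (by dsimp only; omega), if_pos rfl, if_pos ⟨rfl, hne i h1⟩,
          hclear i h1 h2, Sym2.eq_swap]
      rw [edgesOf_append, hME, Set.image_union, Set.image_pair, hj1 i h1 h2, hj2]
      ext e
      simp only [List.cons_append, List.nil_append, edgesOf_cons, edgesOf_nil, Item.edges,
        Set.mem_union, Set.mem_insert_iff, Set.mem_singleton_iff, Set.mem_empty_iff_false]
      tauto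
    · simp only [hm, decide_false, if_false, Bool.false_eq_true]
      apply hloop
      intro i L h1 h2 hL
      refine Spec.weaken (Spec.bind_eq (firstElement_spec _ _ i) (B' := 4) ?_) (by omega)
      iterate 3 apply Spec.op_bind
      apply Spec.op
      obtain ⟨M, hM, hME⟩ := hH i (by omega) h2
      rw [hM, List.append_assoc]
      refine hstep i L _ h1 hL ?_
      have hj2 : parentEdge n m j (n ^ (k + 1) * b + (i - 1) * n ^ k, j + (n + m) / 2) =
          s((n ^ (k + 1) * b + (i - 1) * n ^ k, j),
            (n ^ (k + 1) * b + (i - 1) * n ^ k, j + (n + m) / 2)) := by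
        rw [parentEdge, parent, if_neg (by dsimp only; omega), if_pos rfl,
          if_neg (fun h => hm h.1), Sym2.eq_swap]
      rw [edgesOf_append, edgesOf_cons, hME, Set.image_union, Set.image_pair, hj1 i h1 h2, hj2]
      ext e
      simp only [edgesOf_cons, edgesOf_nil, Item.edges, Set.mem_union, Set.mem_insert_iff,
        Set.mem_singleton_iff, Set.mem_empty_iff_false]
      tauto
  · omega

/-- The trees in a copy of `L-RCube(n,m,1)`; for `n = 1` this is a single element. -/
theorem baseTrees_spec {n m t q : ℕ} (hn : 1 ≤ n)
    (ht : t = if n = 1 then (n + m) / 2 else min n ((n + m) / 2)) (hq : n ∣ q) :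
    Spec (baseTrees n m q) (fun A => ∀ j, 1 ≤ j → j ≤ t → IsTreeList n m j q n (A j))
      (50 * (n * (n + m))) := by
  have hts : t ≤ (n + m) / 2 := by
    rw [ht]
    split_ifs <;> omega
  apply Spec.weaken
  · apply Spec.bind_eq (treeCount_spec ht)
    apply Spec.newArray_bind
    refine Spec.bind (forLoop_fill_spec (fun i A => ∀ j, 1 ≤ j → j ≤ (n + m) / 2 →
      IsTreeList n m j (q + (i - 1) * 1) 1 (A j)) (6 * (n + m) + 8) ?_)
      (B' := t + 1 + (t * (10 * n + 9 + 1) + 1)) ?_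
    · intro i H h1 h2
      apply Spec.weaken
      · apply Spec.bind_eq (firstElement_spec _ _ i)
        apply Spec.op_bind
        exact Spec.bind (completeTrees_spec n m _) fun A hA =>
            Spec.op (Q := fun H' => ∃ A, H' = Function.update H i A ∧ _)
          ⟨A, rfl, hA⟩
      · omega
    · intro H hH
      apply Spec.newArray_bind
      apply forLoop_fill_spec (fun j L => IsTreeList n m j q n L) (10 * n + 9)
      intro j T h1 h2
      by_cases hn1 : n = 1
      · subst hn1
        refine Spec.weaken (B := 4) (Spec.op_bind ?_) (by omega)
        rw [if_pos (by simp)]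
        iterate 2 apply Spec.op_bind
        exact Spec.op ⟨_, rfl, by simpa using hH 1 le_rfl le_rfl j h1 (h2.trans hts)⟩
      · refine Spec.weaken (B := 10 * n + 7 + 1 + 1) (Spec.op_bind ?_) (by omega)
        rw [if_neg (by simpa using hn1)]
        refine Spec.bind (P := IsTreeList n m j q n) ?_ fun L hL => Spec.op ⟨L, rfl, hL⟩
        have := joinTree_spec (k := 0) (H := H) hn h1 (h2.trans hts) (by simpa using hq)
          (by simpa using fun i a b => hH i a b j h1 (h2.trans hts))
        simpa using this
  · have e1 : t * n ≤ (n + m) * n := Nat.mul_le_mul_right _ (by omega)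
    have e2 : n + m ≤ n * (n + m) := Nat.le_mul_of_pos_left _ hn
    have e3 : t * (10 * n + 9 + 1) = 10 * (t * n) + 10 * t := by ring
    have e4 : n * (6 * (n + m) + 8 + 1) = 6 * (n * (n + m)) + 9 * n := by ring
    rw [e3, e4, mul_comm (n + m) n] at *
    omega

/-- The bound on the number of steps has the form `200 n ^ (k + 1) (n + m) - 60 (n (n + m) + k)`:
from one level of the recursion to the next, the subtracted term leaves room for the cost of
joining the trees of the copies. -/
theorem recTrees_spec {n m t : ℕ} (hn : 2 ≤ n) (ht : t = min n ((n + m) / 2)) (k : ℕ) :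
    ∀ q, n ^ (k + 1) ∣ q → ∃ B, B + 60 * (n * (n + m) + k) ≤ 200 * (n ^ (k + 1) * (n + m)) ∧
      Spec (recTrees n m (k + 1) q)
        (fun A => ∀ j, 1 ≤ j → j ≤ t → IsTreeList n m j q (n ^ (k + 1)) (A j)) B := by
  have hn1 : n ≠ 1 := by omega
  have htc : t = if n = 1 then (n + m) / 2 else min n ((n + m) / 2) := by rw [if_neg hn1, ht]
  have hNpos : 0 < n * (n + m) := Nat.mul_pos (by omega) (by omega)
  induction k with
  | zero =>
    intro q hq
    rw [zero_add, pow_one] at *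
    refine ⟨4 + (50 * (n * (n + m)) + 1 + 1), by omega, ?_⟩
    refine Spec.bind_eq (treeCount_spec htc) (Spec.op_bind (Spec.op_bind ?_))
    rw [if_pos (by simp)]
    exact baseTrees_spec (by omega) htc hq
  | succ k ih =>
    intro q hq
    -- The bound for a copy is the same for all copies.
    obtain ⟨B, hB⟩ : ∃ B, B + 60 * (n * (n + m) + k) = 200 * (n ^ (k + 1) * (n + m)) := by
      obtain ⟨B, hB, -⟩ := ih 0 (dvd_zero _)
      exact ⟨_, Nat.sub_add_cancel (by omega)⟩
    have ihB : ∀ i, Spec (recTrees n m (k + 1) (q + (i - 1) * n ^ (k + 1))) (fun A =>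
        ∀ j, 1 ≤ j → j ≤ t → IsTreeList n m j (q + (i - 1) * n ^ (k + 1)) (n ^ (k + 1)) (A j)) B := by
      intro i
      obtain ⟨B', hB', h⟩ := ih (q + (i - 1) * n ^ (k + 1))
        (Dvd.dvd.add ((pow_dvd_pow n (by omega)).trans hq) (dvd_mul_left _ _))
      exact h.weaken (by omega)
    refine ⟨4 + ((2 * (k + 1) + 1) + (n + 1 + ((n * (B + 4 + 1) + 1) +
      (t + 1 + (t * (10 * n + 8 + 1) + 1)))) + 1 + 1 + 1), ?_, ?_⟩
    · have e1 : t * n ≤ n * (n + m) := by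
        rw [mul_comm]
        exact Nat.mul_le_mul_left _ (by omega)
      have e2 : n + m ≤ n * (n + m) := Nat.le_mul_of_pos_left _ (by omega)
      have e3 : t * (10 * n + 8 + 1) = 10 * (t * n) + 9 * t := by ring
      have e4 : n * (B + 4 + 1) = n * B + 5 * n := by ring
      have e5 : n * B + 60 * (n * (n * (n + m)) + n * k) = 200 * (n ^ (k + 1 + 1) * (n + m)) := by
        have := congrArg (n * ·) hB
        rw [pow_succ n (k + 1)]
        linarith
      have e6 : 2 * (n * (n + m)) ≤ n * (n * (n + m)) := Nat.mul_le_mul_right _ hn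
      have e7 : 2 * k ≤ n * k := Nat.mul_le_mul_right _ hn
      rw [e3, e4]
      omega
    · apply Spec.bind_eq (treeCount_spec htc)
      iterate 2 apply Spec.op_bind
      rw [if_neg (by simp [hn1])]
      apply Spec.op_bind
      apply Spec.bind_eq (power_spec n (k + 1))
      apply Spec.newArray_bind
      refine Spec.bind (forLoop_fill_spec (fun i A => ∀ j, 1 ≤ j → j ≤ t →
        IsTreeList n m j (q + (i - 1) * n ^ (k + 1)) (n ^ (k + 1)) (A j)) (B + 4) ?_) ?_
      · intro i H h1 h2
        apply Spec.weaken
        · apply Spec.bind_eq (firstElement_spec _ _ i)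
          exact Spec.bind (ihB i) fun A hA =>
            Spec.op (Q := fun H' => ∃ A, H' = Function.update H i A ∧ _)
            ⟨A, rfl, hA⟩
        · omega
      · intro H hH
        apply Spec.newArray_bind
        apply forLoop_fill_spec (fun j L => IsTreeList n m j q (n ^ (k + 1 + 1)) L) (10 * n + 8)
        intro j T h1 h2
        refine Spec.bind (B' := 1) (joinTree_spec (by omega) h1 (by omega) hq
          fun i a b => hH i a b j h1 h2) fun L hL => Spec.op ⟨L, rfl, hL⟩

theorem cistAlgorithm_spec {n m k t : ℕ} (hn : 1 ≤ n) (hN : 4 ≤ n + m) (hk : 1 ≤ k)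
    (ht : t = if n = 1 then (n + m) / 2 else min n ((n + m) / 2)) :
    Spec (cistAlgorithm n m k)
      (fun r => r.1 = t ∧ ∀ j, 1 ≤ j → j ≤ t → IsTreeList n m j 0 (n ^ k) (r.2 j))
      (210 * (n ^ k * (n + m))) := by
  have hpos : n + m ≤ n ^ k * (n + m) := Nat.le_mul_of_pos_left _ (pow_pos hn k)
  obtain ⟨k, rfl⟩ := Nat.exists_eq_add_of_le' hk
  have hrec : Spec (recTrees n m (k + 1) 0)
      (fun A => ∀ j, 1 ≤ j → j ≤ t → IsTreeList n m j 0 (n ^ (k + 1)) (A j))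
      (200 * (n ^ (k + 1) * (n + m))) := by
    by_cases hn1 : n = 1
    · subst hn1
      apply Spec.weaken
      · unfold recTrees
        apply Spec.bind_eq (treeCount_spec ht)
        iterate 2 apply Spec.op_bind
        rw [if_pos (by simp)]
        simpa only [one_pow] using baseTrees_spec hn ht (dvd_zero _)
      · simp only [one_pow]
        omega
    · obtain ⟨B, hB, h⟩ := recTrees_spec (m := m) (by omega) (ht.trans (if_neg hn1)) k 0 (dvd_zero _)
      exact h.weaken (by omega)
  refine Spec.weaken (Spec.bind_eq (treeCount_spec ht) (Spec.bind hrec fun A hA =>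
    Spec.pure ⟨rfl, hA⟩)) (by omega)

end RCube

theorem theorem4 :
    ∃ C : ℕ, ∀ n m k t : ℕ, 1 ≤ n → 4 ≤ n + m → 2 ≤ k →
      t = (if n = 1 then (1 + m) / 2 else min n ((n + m) / 2)) →
      (RCube.cistAlgorithm n m k).steps ≤ C * (n ^ k * (n + m)) ∧
      (RCube.cistAlgorithm n m k).val.1 = t ∧
      ∃ T : Fin t → SimpleGraph (RCube.Server n m k),
        RCube.IsCIST (RCube.logicGraph n m k) T ∧
        ∀ j : Fin t,
          RCube.Represents ((RCube.cistAlgorithm n m k).val.2 ((j : ℕ) + 1)) (T j) := by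
  refine ⟨210, fun n m k t hn hN hk ht => ?_⟩
  have ht' : t = if n = 1 then (n + m) / 2 else min n ((n + m) / 2) := by
    rw [ht]
    split_ifs with h
    · rw [h]
    · rfl
  have hts : t ≤ (n + m) / 2 ∧ (n = 1 ∨ t ≤ n) := by
    rw [ht']
    split_ifs <;> omega
  obtain ⟨⟨h1, h2⟩, h3⟩ := RCube.cistAlgorithm_spec hn hN (by omega : 1 ≤ k) ht'
  exact ⟨h3, h1, _, RCube.parentTree_isCIST hn hts.1 hts.2, fun j =>
    RCube.represents_parentTree hn (by omega) (by omega) (h2 _ (by omega) (by omega))⟩
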